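/- **Conventions.** Let $\Sigma$ be a finite alphabet. A multiple context-free grammar over $\Sigma$ has a finite set of non-terminals, each with a rank $\ge 1$, a start non-terminal $S$ of rank $1$, and finitely many rules $$A(s_1,\dots,s_m)\leftarrow B_1(x^1_1,\dots,x^1_{k_1}),\dots,B_n(x^n_1,\dots,x^n_{k_n})\qquad(n\ge 0),$$ where $A,B_1,\dots,B_n$ are non-terminals of ranks $m,k_1,\dots,k_n$, and $s_1,\dots,s_m$ are words in letters of $\Sigma$ and the distinct variables $x^i_j$, each variable occurring at most once in $s_1\cdots s_m$. Such a rule produces a value of $A$ (an $m$-tuple of words) from values of $B_1,\dots,B_n$ by substitution; the values of non-terminals are the tuples obtained by finitely many applications of rules, and the language of the grammar is the set of values of $S$. A language $L\subseteq\Sigma^*$ is *$k$-multiple context-free* ($k\ge 1$) if it is the language of such a grammar in which all ranks are at most $k$. A word $w\in L$ is *$(\alpha,\beta)$-pumpable* if $w=xyz$ with $x,y,z\in\Sigma^*$, $\alpha\le|y|\le\beta$ and $xy^nz\in L$ for all $n\ge 0$. For $U\subseteq(\Sigma^*)^s$, a *$U$-switchable factorisation* of $w\in L$ is a factorisation $w=w_0u_1w_1\cdots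 u_sw_s$ with $(u_1,\dots,u_s)\in U$ such that $w_0v_1w_1\cdots v_sw_s\in L$ for every $(v_1,\dots,v_s)\in U$. Any set of positions of a word may be declared *marked*; $|\cdot|_\#$ denotes the number of marked letters of a word, or of a factor of it. **Theorem (Substitution Lemma).** Let $L$ be an infinite $k$-multiple context-free language over $\Sigma$ and let $\mu\ge 1$ be an integer. Then there exist an integer $M\ge1$, integers $m_1,\dots,m_M\in\{1,\dots,k\}$ and sets $U_i\subseteq(\Sigma^*)^{m_i}$ ($1\le i\le M$) such that the following hold. 1. For each $i$ and each $(u_1,\dots,u_{m_i})\in U_i$ there is a word $w\in L$ with a $U_i$-switchable factorisation $w=w_0u_1w_1\cdots u_{m_i}w_{m_i}$. 2. For every integer $\lambda\ge1$ there is an integer $N_\lambda\ge1$ such that every $w\in L$, with any marking such that $|w|_\#\ge N_\lambda$, either is $(\mu,N_\lambda)$-pumpable, or, for some $i$ with $U_i$ infinite, has a $U_i$-switchable factorisation $w=w_0u_1w_1\cdots u_{m_i}w_{m_i}$ with $$\sum_{j=0}^{m_i}|w_j|_\#\ge\lambda\quad\text{and}\quad\sum_{j=1}^{m_i}|u_j|_\#\ge\mu.$$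 3. There is an integer $N_\mu\ge1$ such that every $w\in L$, with any marking such that $|w|_\#\ge N_\mu$, either is $(\mu,N_\mu)$-pumpable, or, for some $i$ with $U_i$ infinite, has a $U_i$-switchable factorisation $w=w_0u_1w_1\cdots u_{m_i}w_{m_i}$ with $$\mu\le\sum_{j=1}^{m_i}|u_j|_\#\le N_\mu.$$ -/

import Mathlib

/-- A rule `A(s₁, …, s_m) ← B₁(x₁¹, …), …, Bₙ(x₁ⁿ, …)` of a multiple context-free grammar with
terminals `α` and non-terminals `NT`, where the non-terminal `A` has `rank A` arguments.
The variable `⟨i, j⟩` is the `j`-th argument of the `i`-th non-terminal on the right, and each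
`s_l` is a string of terminals (`Sum.inl`) and variables (`Sum.inr`). Initial rules
`A(t₁, …, t_m) ←` are those with `arity = 0`. -/
structure MCFRule (α : Type*) (NT : Type) (rank : NT → ℕ) where
  lhs : NT
  arity : ℕ
  rhs : Fin arity → NT
  out : Fin (rank lhs) → List (α ⊕ (Σ i : Fin arity, Fin (rank (rhs i))))
  /-- every variable is used at most once in the concatenation `s₁ ⋯ s_m` -/
  linear : ((List.ofFn out).flatten.filterMap Sum.getRight?).Nodup

/-- The value of the left-hand side of a rule when the variables take the values `v`. -/
def MCFRule.eval {α : Type*} {NT : Type} {rank : NT → ℕ} (r : MCFRule α NT rank)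
    (v : (i : Fin r.arity) → Fin (rank (r.rhs i)) → List α) : Fin (rank r.lhs) → List α :=
  fun l => (r.out l).flatMap (Sum.elim (fun a => [a]) (fun x => v x.1 x.2))

/-- A multiple context-free grammar over the terminals `α`. -/
structure MCFGrammar (α : Type*) where
  NT : Type
  finite_NT : Finite NT
  rank : NT → ℕ
  rank_pos : ∀ A, 1 ≤ rank A
  rules : Set (MCFRule α NT rank)
  finite_rules : rules.Finite
  start : NT
  rank_start : rank start = 1

/-- `G.Derives A t`: the tuple of words `t` is a value of the non-terminal `A`, that is, it is
obtained by finitely many applications of rules, the last of which has `A` on the left. -/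
inductive MCFGrammar.Derives {α : Type*} (G : MCFGrammar α) :
    (A : G.NT) → (Fin (G.rank A) → List α) → Prop
  | rule (r : MCFRule α G.NT G.rank) (hr : r ∈ G.rules)
      (v : (i : Fin r.arity) → Fin (G.rank (r.rhs i)) → List α)
      (hv : ∀ i, G.Derives (r.rhs i) (v i)) : G.Derives r.lhs (r.eval v)

/-- The language of a multiple context-free grammar: the values of the start symbol. -/
def MCFGrammar.language {α : Type*} (G : MCFGrammar α) : Language α :=
  {w | G.Derives G.start (fun _ => w)}

/-- `L` is a `k`-multiple context-free language. -/
def IsKMultipleContextFree {α : Type*} (k : ℕ) (L : Language α) : Prop :=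
  ∃ G : MCFGrammar α, (∀ A, G.rank A ≤ k) ∧ G.language = L

/-- The word `w` is `(a, b)`-pumpable in `L`: `w = xyz` with `a ≤ |y| ≤ b` and `x yⁿ z ∈ L` for
all `n ≥ 0`. -/
def IsPumpable {α : Type*} (L : Language α) (a b : ℕ) (w : List α) : Prop :=
  ∃ x y z : List α, w = x ++ y ++ z ∧ a ≤ y.length ∧ y.length ≤ b ∧
    ∀ n : ℕ, x ++ (List.replicate n y).flatten ++ z ∈ L

/-- The word `w₀ u₁ w₁ u₂ w₂ ⋯ u_s w_s`. -/
def interleave {β : Type*} {s : ℕ} (w : Fin (s + 1) → List β) (u : Fin s → List β) : List β :=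
  w 0 ++ (List.ofFn fun j : Fin s => u j ++ w j.succ).flatten

/-- The factorisation `w₀ u₁ w₁ ⋯ u_s w_s` is a `U`-switchable factorisation of a word of `L`. -/
def IsSwitchable {α : Type*} {s : ℕ} (L : Language α) (U : Set (Fin s → List α))
    (w : Fin (s + 1) → List α) (u : Fin s → List α) : Prop :=
  interleave w u ∈ L ∧ u ∈ U ∧ ∀ v ∈ U, interleave w v ∈ L

/-- A word in which some of the letters are marked (those whose second component is `true`). -/
abbrev MarkedWord (α : Type*) := List (α × Bool)

/-- The underlying word of a marked word. -/
def MarkedWord.word {α : Type*} (x : MarkedWord α) : List α := List.map Prod.fst x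

/-- The number `|x|_#` of marked letters. -/
def MarkedWord.marks {α : Type*} (x : MarkedWord α) : ℕ := List.countP Prod.snd x

/-!
The switchable sets are the sets of values of the non-terminals. A derivation of a word of the
language with a subtree for the non-terminal `A` removed is a word with holes, one for each argument
of `A` that reaches the final word; any value of `A` may be put into the holes. Arguments may be
deleted or permuted on the way to the root, so a switchable set is given by `A` together with a list
of distinct arguments of `A` that occurs in this way (`MCFGrammar.Occurrence`). There are finitely
many such pairs, and the list has at most `rank A ≤ k` members.

To find a factorisation of a heavily marked word, let the weight of a node of its derivation tree
be the number of marked letters that the word inherits from it. Let every rule have at most `a`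
non-terminals on the right and at most `C` letters on the left. Descending from
the root as long as some child has weight more than `T ≥ C` leads to a node of weight `W` with
`W ≤ T < a * W + C` (`MCFGrammar.Derives.exists_context`). If `T` is large, then so is `W`, and the
set of values at that node has a member longer than all members of the finite sets among the
switchable sets, so that it is infinite (`MCFGrammar.exists_switchable`). A fixed `T` bounds the
number of marks inside, and taking for `T` the number of marks of the word minus `l` leaves at
least `l` marks outside. Hence words with enough marks always have the switchable factorisation.

As a subtree is removed from a derivation of an unmarked word, the marks have to be carried along:
`Template.exists_lift` transports them from a word to the rules and values that it is made of, which
is possible since every variable is used at most once.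
-/

/-! ### Templates: words with holes -/

/-- A word over `β` with holes named by `ι`. The components of the output of a rule are templates
whose holes are the variables; a derivation with one subtree removed is a template whose holes are
the arguments of the missing non-terminal. -/
abbrev Template (β ι : Type*) := List (β ⊕ ι)

namespace Template

variable {β γ ι κ : Type*}

/-- Fill every hole `i` of a template with the word `v i`. -/
def fill (c : Template β ι) (v : ι → List β) : List β :=
  c.flatMap (Sum.elim (fun a => [a]) v)

/-- The holes of a template, from left to right and with repetitions. -/
def holes (c : Template β ι) : List ι := c.filterMap Sum.getRight?

/-- The letters of a template outside its holes. -/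
def letters (c : Template β ι) : List β := c.filterMap Sum.getLeft?

/-- Replace every hole `i` of a template by the template `f i`. -/
def bind (f : ι → Template β κ) (c : Template β ι) : Template β κ :=
  c.flatMap (Sum.elim (fun a => [Sum.inl a]) f)

@[simp] theorem fill_nil (v : ι → List β) : fill [] v = [] := rfl

@[simp] theorem fill_inl (a : β) (c : Template β ι) (v : ι → List β) :
    fill (Sum.inl a :: c) v = a :: fill c v := rfl

@[simp] theorem fill_inr (i : ι) (c : Template β ι) (v : ι → List β) :
    fill (Sum.inr i :: c) v = v i ++ fill c v := rfl

@[simp] theorem fill_append (c d : Template β ι) (v : ι → List β) :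
    fill (c ++ d) v = fill c v ++ fill d v := by simp [fill]

@[simp] theorem fill_map_inl (x : List β) (v : ι → List β) : fill (x.map Sum.inl) v = x := by
  induction x with
  | nil => rfl
  | cons a x ih => simp [ih]

@[simp] theorem holes_nil : holes ([] : Template β ι) = [] := rfl

@[simp] theorem holes_inl (a : β) (c : Template β ι) : holes (Sum.inl a :: c) = holes c := rfl

@[simp] theorem holes_inr (i : ι) (c : Template β ι) : holes (Sum.inr i :: c) = i :: holes c := rfl

@[simp] theorem holes_append (c d : Template β ι) : holes (c ++ d) = holes c ++ holes d :=
  List.filterMap_append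

@[simp] theorem holes_map_inl (x : List β) : holes (x.map Sum.inl : Template β ι) = [] := by
  induction x with
  | nil => rfl
  | cons a x ih => simp [ih]

@[simp] theorem letters_inl (a : β) (c : Template β ι) :
    letters (Sum.inl a :: c) = a :: letters c := rfl

@[simp] theorem letters_inr (i : ι) (c : Template β ι) : letters (Sum.inr i :: c) = letters c := rfl

@[simp] theorem bind_inl (f : ι → Template β κ) (a : β) (c : Template β ι) :
    bind f (Sum.inl a :: c) = Sum.inl a :: bind f c := rfl

@[simp] theorem bind_inr (f : ι → Template β κ) (i : ι) (c : Template β ι) :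
    bind f (Sum.inr i :: c) = f i ++ bind f c := rfl

theorem fill_bind (f : ι → Template β κ) (c : Template β ι) (v : κ → List β) :
    fill (bind f c) v = fill c fun i => fill (f i) v := by
  induction c with
  | nil => rfl
  | cons s c ih => cases s <;> simp [ih]

theorem holes_bind (f : ι → Template β κ) (c : Template β ι) :
    holes (bind f c) = (holes c).flatMap fun i => holes (f i) := by
  induction c with
  | nil => rfl
  | cons s c ih => cases s <;> simp [ih]

theorem fill_congr {c : Template β ι} {v v' : ι → List β} (h : ∀ i ∈ holes c, v i = v' i) :
    fill c v = fill c v' := by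
  induction c with
  | nil => rfl
  | cons s c ih => cases s <;> simp_all

theorem holes_map (g : β → γ) (c : Template β ι) : holes (c.map (Sum.map g id)) = holes c := by
  induction c with
  | nil => rfl
  | cons s c ih => cases s <;> simp [ih]

theorem letters_map (g : β → γ) (c : Template β ι) :
    letters (c.map (Sum.map g id)) = (letters c).map g := by
  induction c with
  | nil => rfl
  | cons s c ih => cases s <;> simp [ih]

theorem map_fill (g : β → γ) (c : Template β ι) (v : ι → List β) :
    (fill c v).map g = fill (c.map (Sum.map g id)) fun i => (v i).map g := by
  induction c with
  | nil => rfl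
  | cons s c ih => cases s <;> simp [ih]

/-- Filling a template is interleaving: the words `w` are the maximal factors between holes. -/
theorem exists_fill_eq_interleave (c : Template β ι) :
    ∃ w : Fin (c.holes.length + 1) → List β,
      ∀ v : ι → List β, c.fill v = interleave w fun j => v (c.holes.get j) := by
  induction c with
  | nil => exact ⟨fun _ => [], fun v => by simp [interleave]⟩
  | cons s c ih =>
    obtain ⟨w, hw⟩ := ih
    cases s with
    | inl a =>
      refine ⟨Fin.cons (a :: w 0) fun j => w j.succ, fun v => ?_⟩
      simp only [fill_inl, hw, interleave]
      rfl
    | inr i =>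
      refine ⟨Fin.cons [] w, fun v => ?_⟩
      simp only [fill_inr, hw, interleave]
      change _ = [] ++ (List.ofFn fun j : Fin ((holes c).length + 1) => _).flatten
      rw [List.ofFn_succ]
      simp

/-- A decoration of the letters of a filled template is inherited by the template and by the words
filled in. The holes have to be distinct, as one word cannot inherit two decorations. -/
theorem exists_lift (g : β → γ) (hg : Function.Surjective g) (c : Template γ ι)
    (hc : c.holes.Nodup) (v : ι → List γ) (x : List β) (hx : x.map g = c.fill v) :
    ∃ (c' : Template β ι) (v' : ι → List β), c'.map (Sum.map g id) = c ∧
      (∀ i, (v' i).map g = v i) ∧ x = c'.fill v' := by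
  classical
  induction c generalizing x with
  | nil =>
    choose v' hv' using fun i => List.map_surjective_iff.2 hg (v i)
    exact ⟨[], v', rfl, hv', by simpa using hx⟩
  | cons s c ih =>
    cases s with
    | inl a =>
      rw [fill_inl, List.map_eq_cons_iff] at hx
      obtain ⟨b, y, rfl, rfl, hy⟩ := hx
      obtain ⟨c', v', h1, h2, rfl⟩ := ih (by simpa using hc) y hy
      exact ⟨Sum.inl b :: c', v', by simp [h1], h2, rfl⟩
    | inr i =>
      rw [fill_inr, List.map_eq_append_iff] at hx
      obtain ⟨y, z, rfl, hy, hz⟩ := hx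
      rw [holes_inr, List.nodup_cons] at hc
      obtain ⟨c', v', h1, h2, rfl⟩ := ih hc.2 z hz
      refine ⟨Sum.inr i :: c', Function.update v' i y, by simp [h1], fun j => ?_, ?_⟩
      · obtain rfl | hj := eq_or_ne j i
        · simpa using hy
        · simpa [hj] using h2 j
      · rw [fill_inr, Function.update_self]
        congr 1
        refine fill_congr fun j hj => ?_
        have : j ≠ i := by
          rintro rfl
          rw [← h1, holes_map] at hc
          exact hc.1 hj
        simp [this]

/-- The simultaneous form of `Template.exists_lift`, for a family of templates no two of which
share a hole. -/
theorem exists_lift_family (g : β → γ) (hg : Function.Surjective g) (c : κ → Template γ ι)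
    (hc : ∀ l, (c l).holes.Nodup)
    (hd : ∀ l l' i, i ∈ (c l).holes → i ∈ (c l').holes → l = l')
    (v : ι → List γ) (x : κ → List β) (hx : ∀ l, (x l).map g = (c l).fill v) :
    ∃ (c' : κ → Template β ι) (v' : ι → List β), (∀ l, (c' l).map (Sum.map g id) = c l) ∧
      (∀ i, (v' i).map g = v i) ∧ ∀ l, x l = (c' l).fill v' := by
  classical
  choose c' v' h1 h2 h3 using fun l => exists_lift g hg (c l) (hc l) v (x l) (hx l)
  choose v₀ hv₀ using fun i => List.map_surjective_iff.2 hg (v i)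
  refine ⟨c', fun i => if h : ∃ l, i ∈ (c l).holes then v' h.choose i else v₀ i, h1, ?_, ?_⟩
  · intro i
    dsimp only
    split_ifs with h
    · exact h2 _ i
    · exact hv₀ i
  · intro l
    rw [h3 l]
    refine fill_congr fun i hi => ?_
    rw [← holes_map g, h1] at hi
    have h : ∃ l, i ∈ (c l).holes := ⟨l, hi⟩
    rw [dif_pos h, hd l h.choose i hi h.choose_spec]

end Template

theorem map_interleave {β γ : Type*} {s : ℕ} (g : β → γ) (w : Fin (s + 1) → List β)
    (u : Fin s → List β) :
    (interleave w u).map g = interleave (fun j => (w j).map g) fun j => (u j).map g := by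
  simp [interleave, List.map_flatten, List.map_ofFn, Function.comp_def]

/-! ### Marks -/

namespace MarkedWord

variable {α : Type*}

theorem marks_append (x y : MarkedWord α) :
    marks (x ++ y : MarkedWord α) = marks x + marks y := List.countP_append

theorem marks_le_length (x : MarkedWord α) : x.marks ≤ x.word.length := by
  simpa [word, marks] using List.countP_le_length (p := Prod.snd) (l := x)

theorem marks_interleave {s : ℕ} (w : Fin (s + 1) → MarkedWord α) (u : Fin s → MarkedWord α) :
    marks (interleave w u : MarkedWord α) = ∑ j, (w j).marks + ∑ j, (u j).marks := by
  have h : ∀ l : List (List (α × Bool)), marks (l.flatten : MarkedWord α) = (l.map marks).sum := by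
    intro l
    simp only [marks, List.countP_flatten]
    rfl
  simp only [interleave, marks_append, h, List.map_ofFn, List.sum_ofFn, Function.comp_def,
    Finset.sum_add_distrib, Fin.sum_univ_succ]
  ring

end MarkedWord

namespace Template

variable {α ι κ : Type*}

/-- The number of marked letters in the holes of a template filled with `v`. -/
def holeMarks (c : Template (α × Bool) ι) (v : ι → MarkedWord α) : ℕ :=
  (c.holes.map fun i => (v i).marks).sum

theorem marks_fill (c : Template (α × Bool) ι) (v : ι → MarkedWord α) :
    MarkedWord.marks (c.fill v) = MarkedWord.marks c.letters + c.holeMarks v := by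
  induction c with
  | nil => rfl
  | cons s c ih =>
    cases s with
    | inl a =>
      simp only [holeMarks, fill_inl, letters_inl, holes_inl] at ih ⊢
      simp only [MarkedWord.marks, List.countP_cons] at ih ⊢
      omega
    | inr i =>
      simp only [holeMarks, fill_inr, letters_inr, holes_inr, List.map_cons, List.sum_cons] at ih ⊢
      rw [MarkedWord.marks_append, ih]
      omega

theorem holeMarks_bind (f : ι → Template (α × Bool) κ) (c : Template (α × Bool) ι)
    (v : κ → MarkedWord α) :
    (bind f c).holeMarks v = (c.holes.map fun i => (f i).holeMarks v).sum := by
  simp only [holeMarks, holes_bind]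
  induction c.holes with
  | nil => rfl
  | cons i l ih => simp [ih]

end Template

/-! ### Removing a subtree from a derivation -/

namespace Template

variable {β I : Type*} {J : I → Type*} [DecidableEq I]

/-- The substitution that keeps the holes belonging to the family `J i` and fills all the other
holes by `v`. -/
def isolate (v : (Σ i, J i) → List β) (i : I) (x : Σ i, J i) : Template β (J i) :=
  if h : x.1 = i then [Sum.inr (h ▸ x.2)] else (v x).map Sum.inl

theorem fill_isolate (v : (Σ i, J i) → List β) (i : I) (x : Σ i, J i) (u : J i → List β) :
    (isolate v i x).fill u = Function.update (fun i j => v ⟨i, j⟩) i u x.1 x.2 := by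
  obtain ⟨i', j⟩ := x
  by_cases h : i' = i
  · subst h
    simp [isolate]
  · simp [isolate, h]

theorem fill_isolate_self (v : (Σ i, J i) → List β) (i : I) (x : Σ i, J i) :
    (isolate v i x).fill (fun j => v ⟨i, j⟩) = v x := by
  rw [fill_isolate, Function.update_eq_self i fun i j => v ⟨i, j⟩]

theorem nodup_holes_bind_isolate {d : Template β (Σ i, J i)} (hd : d.holes.Nodup)
    (v : (Σ i, J i) → List β) (i : I) : (bind (isolate v i) d).holes.Nodup := by
  rw [holes_bind, List.nodup_flatMap]
  constructor
  · intro x _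
    unfold isolate
    split_ifs <;> simp
  · refine hd.imp ?_
    rintro ⟨i₁, j₁⟩ ⟨i₂, j₂⟩ hne
    by_cases h₁ : i₁ = i
    · by_cases h₂ : i₂ = i
      · subst h₁
        subst h₂
        have : j₁ ≠ j₂ := by
          rintro rfl
          exact hne rfl
        simpa [isolate, Function.onFun] using this.symm
      · simp [isolate, Function.onFun, h₂]
    · simp [isolate, Function.onFun, h₁]

theorem sum_holeMarks_bind_isolate {α : Type*} [Fintype I] (d : Template (α × Bool) (Σ i, J i))
    (v : (Σ i, J i) → MarkedWord α) :
    ∑ i, (bind (isolate v i) d).holeMarks (fun j => v ⟨i, j⟩) = d.holeMarks v := by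
  have h (i : I) (x : Σ i, J i) : (isolate v i x).holeMarks (fun j => v ⟨i, j⟩) =
      if x.1 = i then (v x).marks else 0 := by
    obtain ⟨i', j⟩ := x
    by_cases h : i' = i
    · subst h
      simp [isolate, holeMarks]
    · simp [isolate, holeMarks, h]
  simp only [holeMarks_bind, h]
  unfold holeMarks
  induction d.holes with
  | nil => simp
  | cons x l ih => simp [Finset.sum_add_distrib, ih]

end Template

open Template in
theorem MCFRule.nodup_holes {α : Type*} {NT : Type} {rank : NT → ℕ} (r : MCFRule α NT rank)
    (l : Fin (rank r.lhs)) : holes (r.out l) |>.Nodup := by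
  have h := r.linear
  rw [List.filterMap_flatten, List.nodup_flatten] at h
  exact h.1 _ (by simp [holes])

open Template in
theorem MCFRule.eq_of_mem_holes {α : Type*} {NT : Type} {rank : NT → ℕ} (r : MCFRule α NT rank)
    (l l' : Fin (rank r.lhs)) (x) (hx : x ∈ holes (r.out l)) (hx' : x ∈ holes (r.out l')) :
    l = l' := by
  have h := r.linear
  rw [List.filterMap_flatten, List.nodup_flatten, List.map_ofFn, List.pairwise_ofFn] at h
  obtain hlt | heq | hlt := lt_trichotomy l l'
  · exact (h.2 hlt hx hx').elim
  · exact heq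
  · exact (h.2 hlt hx' hx).elim

namespace MCFGrammar

open Template

variable {α : Type*}

/-- A derivation of a word of the language with a subtree for `A` removed, as seen from `A`: a
template in which each argument of `A` occurs at most once and which any value of `A` completes to
a word of the language. The letters of the template carry marks; those of the values are
irrelevant. -/
def IsContext (G : MCFGrammar α) (A : G.NT) (c : Template (α × Bool) (Fin (G.rank A))) : Prop :=
  c.holes.Nodup ∧ ∀ v : Fin (G.rank A) → MarkedWord α,
    G.Derives A (fun j => (v j).word) → MarkedWord.word (c.fill v) ∈ G.language

theorem isContext_start (G : MCFGrammar α) :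
    G.IsContext G.start [Sum.inr (Fin.cast G.rank_start.symm 0)] := by
  refine ⟨by simp, fun v hv => ?_⟩
  have : Subsingleton (Fin (G.rank G.start)) := by
    rw [G.rank_start]
    infer_instance
  change G.Derives G.start _
  convert hv using 2 with j
  simp [Subsingleton.elim j (Fin.cast G.rank_start.symm 0)]

/-- Let `c` be a context for `A`, and let a derivation of the value `v` of `A` begin with the rule
`r`. Then each non-terminal on the right of `r` has a context, which completes to the same word, and
the marks in the holes of `c` are those in the holes of the new contexts together with those on
letters of `r`. -/
theorem IsContext.exists_children {G : MCFGrammar α} {r : MCFRule α G.NT G.rank} (hr : r ∈ G.rules)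
    {t : (i : Fin r.arity) → Fin (G.rank (r.rhs i)) → List α}
    (ht : ∀ i, G.Derives (r.rhs i) (t i)) {c : Template (α × Bool) (Fin (G.rank r.lhs))}
    (hc : G.IsContext r.lhs c) {v : Fin (G.rank r.lhs) → MarkedWord α}
    (hv : ∀ l, (v l).word = r.eval t l) :
    ∃ (d : (i : Fin r.arity) → Template (α × Bool) (Fin (G.rank (r.rhs i))))
      (u : (i : Fin r.arity) → Fin (G.rank (r.rhs i)) → MarkedWord α),
      (∀ i, G.IsContext (r.rhs i) (d i)) ∧ (∀ i j, (u i j).word = t i j) ∧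
      (∀ i, (d i).fill (u i) = c.fill v) ∧
      c.holeMarks v ≤ ∑ l, (letters (r.out l)).length + ∑ i, (d i).holeMarks (u i) := by
  have hsurj : Function.Surjective (Prod.fst : α × Bool → α) := Prod.fst_surjective
  obtain ⟨out', u, hout, hu, hvu⟩ := exists_lift_family (Prod.fst : α × Bool → α) hsurj r.out
    r.nodup_holes r.eq_of_mem_holes (fun x => t x.1 x.2) v hv
  have hh (l) : holes (out' l) = holes (r.out l) := by rw [← hout l, holes_map]
  obtain rfl : v = fun l => (out' l).fill u := funext hvu
  have hd : (bind out' c).holes.Nodup := by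
    rw [holes_bind, List.nodup_flatMap]
    refine ⟨fun l _ => hh l ▸ r.nodup_holes l, hc.1.imp fun {l l'} hne => ?_⟩
    intro x hx hx'
    exact hne (r.eq_of_mem_holes l l' x (hh l ▸ hx) (hh l' ▸ hx'))
  refine ⟨fun i => bind (isolate u i) (bind out' c), fun i j => u ⟨i, j⟩, fun i => ⟨?_, ?_⟩,
    fun i j => hu ⟨i, j⟩, fun i => ?_, ?_⟩
  · exact nodup_holes_bind_isolate hd u i
  · intro v hv
    simp only [fill_bind, fill_isolate]
    refine hc.2 _ ?_
    have key := Derives.rule r hr (Function.update t i fun j => (v j).word) (by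
      intro i'
      obtain rfl | hi := eq_or_ne i' i
      · simpa using hv
      · simpa [hi] using ht i')
    convert key using 2 with l
    rw [MarkedWord.word, map_fill, hout l]
    refine congrArg (fill (r.out l)) (funext fun x => ?_)
    obtain ⟨i', j⟩ := x
    obtain rfl | hi := eq_or_ne i' i
    · simp [MarkedWord.word]
    · simpa [hi] using hu ⟨i', j⟩
  · simp only [fill_bind, fill_isolate_self]
  · rw [sum_holeMarks_bind_isolate, holeMarks_bind]
    simp only [holeMarks, marks_fill, List.sum_map_add]
    gcongr
    rw [← List.sum_toFinset _ hc.1]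
    refine (Finset.sum_le_sum_of_subset (Finset.subset_univ _)).trans
      (Finset.sum_le_sum fun l _ => ?_)
    rw [← hout l, letters_map]
    exact MarkedWord.marks_le_length _

/-- Descend from a node whose used components carry more than `T` marks, always to a child that
still carries more than `T`. At the last such node all children carry at most `T` marks, and
one of the at most `a` children carries its share of what the at most `C` letters of the rule leave
over. -/
theorem Derives.exists_context {G : MCFGrammar α} {a C T : ℕ} (ha : ∀ r ∈ G.rules, r.arity ≤ a)
    (hC : ∀ r ∈ G.rules, ∑ l, (letters (r.out l)).length ≤ C) (hT : C ≤ T) {A : G.NT}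
    {t : Fin (G.rank A) → List α} (h : G.Derives A t) :
    ∀ (c : Template (α × Bool) (Fin (G.rank A))) (v : Fin (G.rank A) → MarkedWord α),
      G.IsContext A c → (∀ j, (v j).word = t j) → T < c.holeMarks v →
      ∃ (B : G.NT) (d : Template (α × Bool) (Fin (G.rank B))) (u : Fin (G.rank B) → MarkedWord α),
        G.IsContext B d ∧ G.Derives B (fun j => (u j).word) ∧ d.fill u = c.fill v ∧
        d.holeMarks u ≤ T ∧ T < a * d.holeMarks u + C := by
  induction h with
  | rule r hr t ht ih =>
    intro c v hc hv hlt
    obtain ⟨d, u, hd, hu, hfill, hle⟩ := hc.exists_children hr ht hv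
    by_cases hbig : ∃ i, T < (d i).holeMarks (u i)
    · obtain ⟨i, hi⟩ := hbig
      obtain ⟨B, d', u', h1, h2, h3, h4⟩ := ih i (d i) (u i) (hd i) (hu i) hi
      exact ⟨B, d', u', h1, h2, h3.trans (hfill i), h4⟩
    · push Not at hbig
      have hCr := hC r hr
      obtain hempty | hne := isEmpty_or_nonempty (Fin r.arity)
      · simp only [Finset.univ_eq_empty, Finset.sum_empty] at hle
        omega
      · obtain ⟨i, hi⟩ := Finite.exists_max fun i => (d i).holeMarks (u i)
        refine ⟨r.rhs i, d i, u i, hd i, ?_, hfill i, hbig i, ?_⟩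
        · simpa only [hu] using ht i
        · have hsum : ∑ i, (d i).holeMarks (u i) ≤ r.arity * (d i).holeMarks (u i) := by
            simpa using Finset.sum_le_card_nsmul Finset.univ _ _ fun i' _ => hi i'
          have := Nat.mul_le_mul_right ((d i).holeMarks (u i)) (ha r hr)
          omega

theorem exists_context_of_mem_language (G : MCFGrammar α) : ∃ a C : ℕ,
    ∀ (T : ℕ) (x : MarkedWord α), x.word ∈ G.language → C ≤ T → T < x.marks →
      ∃ (B : G.NT) (d : Template (α × Bool) (Fin (G.rank B))) (u : Fin (G.rank B) → MarkedWord α),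
        G.IsContext B d ∧ G.Derives B (fun j => (u j).word) ∧ x = d.fill u ∧
        d.holeMarks u ≤ T ∧ T < a * d.holeMarks u + C := by
  obtain ⟨a, ha⟩ := (G.finite_rules.image fun r => r.arity).bddAbove
  obtain ⟨C, hC⟩ :=
    (G.finite_rules.image fun r => ∑ l, (letters (r.out l)).length).bddAbove
  refine ⟨a, C, fun T x hx hT hlt => ?_⟩
  obtain ⟨B, d, u, h1, h2, h3, h4⟩ := Derives.exists_context
    (fun r hr => ha (Set.mem_image_of_mem _ hr)) (fun r hr => hC (Set.mem_image_of_mem _ hr)) hT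
    hx _ (fun _ => x) G.isContext_start (fun _ => rfl) (by simpa [holeMarks] using hlt)
  exact ⟨B, d, u, h1, h2, by simpa using h3.symm, h4⟩

/-! ### The substitutable sets -/

/-- A non-terminal `A` together with a nonempty list of its arguments that occurs, in this order, in
a derivation of some word of the language: there are words `w` around the listed arguments that
every value of `A` completes to a word of the language. -/
def Occurrence (G : MCFGrammar α) : Type :=
  {q : Σ A : G.NT, {p : List (Fin (G.rank A)) // p.Nodup} // q.2.1 ≠ [] ∧
    ∃ w : Fin (q.2.1.length + 1) → List α, ∀ v : Fin (G.rank q.1) → List α, G.Derives q.1 v →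
      interleave w (fun j => v (q.2.1.get j)) ∈ G.language}

namespace Occurrence

variable {G : MCFGrammar α}

instance : Finite G.Occurrence := by
  have := G.finite_NT
  unfold Occurrence
  infer_instance

/-- The arguments listed by an occurrence. -/
def args (q : G.Occurrence) : List (Fin (G.rank q.1.1)) := q.1.2.1

/-- The values of the non-terminal of an occurrence, restricted to the listed arguments. -/
def values (q : G.Occurrence) : Set (Fin q.args.length → List α) :=
  {u | ∃ v, G.Derives q.1.1 v ∧ u = fun j => v (q.args.get j)}

theorem one_le_length_args (q : G.Occurrence) : 1 ≤ q.args.length :=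
  List.length_pos_iff.2 q.2.1

theorem length_args_le (q : G.Occurrence) : q.args.length ≤ G.rank q.1.1 := by
  simpa [args] using q.1.2.2.length_le_card

theorem exists_isSwitchable (q : G.Occurrence) {u} (hu : u ∈ q.values) :
    ∃ w, IsSwitchable G.language q.values w u := by
  obtain ⟨w, hw⟩ := q.2.2
  have h : ∀ v ∈ q.values, interleave w v ∈ G.language := by
    rintro _ ⟨v, hv, rfl⟩
    exact hw v hv
  exact ⟨w, h u hu, hu, h⟩

/-- A bound for the total length of the members of those sets of values that are finite. -/
theorem exists_length_le (G : MCFGrammar α) : ∃ K : ℕ, ∀ q : G.Occurrence, q.values.Finite →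
    ∀ u ∈ q.values, ∑ j, (u j).length ≤ K := by
  have h (q : G.Occurrence) : ∃ K : ℕ, q.values.Finite → ∀ u ∈ q.values, ∑ j, (u j).length ≤ K := by
    by_cases hq : q.values.Finite
    · obtain ⟨K, hK⟩ := (hq.image fun u => ∑ j, (u j).length).bddAbove
      exact ⟨K, fun _ u hu => hK (Set.mem_image_of_mem _ hu)⟩
    · exact ⟨0, fun h => (hq h).elim⟩
  choose K hK using h
  obtain ⟨B, hB⟩ := (Set.finite_range K).bddAbove
  exact ⟨B, fun q hq u hu => (hK q hq u hu).trans (hB (Set.mem_range_self q))⟩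

end Occurrence

/-- A context with a hole is a factorisation of the words that complete it, around an occurrence of
the non-terminal. -/
theorem IsContext.exists_occurrence {G : MCFGrammar α} {A : G.NT}
    {c : Template (α × Bool) (Fin (G.rank A))} (hc : G.IsContext A c) (hne : c.holes ≠ []) :
    ∃ (q : G.Occurrence) (w : Fin (q.args.length + 1) → MarkedWord α),
      ∀ v : Fin (G.rank A) → MarkedWord α, G.Derives A (fun j => (v j).word) →
        ∃ u : Fin q.args.length → MarkedWord α, c.fill v = interleave w u ∧
          IsSwitchable G.language q.values (fun j => (w j).word) (fun j => (u j).word) ∧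
          ∑ j, (u j).marks = c.holeMarks v := by
  obtain ⟨w, hw⟩ := c.exists_fill_eq_interleave
  have hmem : ∀ v : Fin (G.rank A) → List α, G.Derives A v →
      interleave (fun j => MarkedWord.word (w j)) (fun j => v (c.holes.get j)) ∈ G.language := by
    intro v hv
    have hword (j) : MarkedWord.word ((v j).map fun a => (a, false)) = v j := by
      simp [MarkedWord.word, Function.comp_def]
    have h := hc.2 (fun j => (v j).map fun a => (a, false)) (by simpa only [hword] using hv)
    rw [hw, MarkedWord.word, map_interleave] at h
    simp only [← MarkedWord.word.eq_1, hword] at h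
    exact h
  let q : G.Occurrence := ⟨⟨A, c.holes, hc.1⟩, hne, _, hmem⟩
  refine ⟨q, w, fun v hv => ⟨fun j => v (c.holes.get j), hw v, ⟨hmem _ hv, ⟨_, hv, rfl⟩, ?_⟩, ?_⟩⟩
  · rintro _ ⟨v', hv', rfl⟩
    exact hmem v' hv'
  · change ∑ j : Fin c.holes.length, (v (c.holes.get j)).marks = _
    rw [← List.sum_ofFn, holeMarks]
    congr 1
    apply List.ext_get <;> simp

instance (G : MCFGrammar α) : Nonempty G.Occurrence := by
  obtain ⟨q, -⟩ := G.isContext_start.exists_occurrence (by simp)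
  exact ⟨q⟩

/-- For every large enough threshold `T`, a word of the language with more than `T` marks has a
factorisation around an infinite set of values with at most `T`, but at least `μ`, marks inside.
That `T` is free, and not only large, is what allows both to bound the marks inside by a constant
and to leave a prescribed number of marks outside. -/
theorem exists_switchable (G : MCFGrammar α) (μ : ℕ) : ∃ T₀ : ℕ,
    ∀ (T : ℕ) (x : MarkedWord α), x.word ∈ G.language → T₀ ≤ T → T < x.marks →
      ∃ q : G.Occurrence, q.values.Infinite ∧
        ∃ (w : Fin (q.args.length + 1) → MarkedWord α) (u : Fin q.args.length → MarkedWord α),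
          x = interleave w u ∧
          IsSwitchable G.language q.values (fun j => (w j).word) (fun j => (u j).word) ∧
          μ ≤ ∑ j, (u j).marks ∧ ∑ j, (u j).marks ≤ T := by
  obtain ⟨a, C, h⟩ := G.exists_context_of_mem_language
  obtain ⟨K, hK⟩ := Occurrence.exists_length_le G
  -- More than `K` marks inside exclude a finite set of values; since `T < a * W + C` for the number
  -- `W` of marks inside, a threshold from `a * (K + μ) + C` on forces `W > K + μ`.
  refine ⟨a * (K + μ) + C, fun T x hx hT hlt => ?_⟩
  obtain ⟨B, d, v, hd, hv, rfl, hle, hgt⟩ := h T x hx (by omega) hlt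
  have hbig : K + μ < d.holeMarks v := by
    by_contra! hcon
    have := Nat.mul_le_mul_left a hcon
    omega
  have hne : d.holes ≠ [] := by
    intro h0
    simp [holeMarks, h0] at hbig
  obtain ⟨q, w, hq⟩ := hd.exists_occurrence hne
  obtain ⟨u, hu, hsw, hmarks⟩ := hq v hv
  refine ⟨q, fun hfin => ?_, w, u, hu, hsw, by omega, by omega⟩
  have h1 := hK q hfin _ hsw.2.1
  have h2 : ∑ j, (u j).marks ≤ ∑ j, (u j).word.length :=
    Finset.sum_le_sum fun j _ => (u j).marks_le_length
  omega

end MCFGrammar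

theorem theorem4p1 {α : Type*} [Finite α] (k : ℕ) (L : Language α)
    (hL : IsKMultipleContextFree k L) (hinf : {w : List α | w ∈ L}.Infinite)
    (μ : ℕ) (hμ : 1 ≤ μ) :
    ∃ (M : ℕ) (m : Fin M → ℕ) (U : (i : Fin M) → Set (Fin (m i) → List α)),
      1 ≤ M ∧ (∀ i, 1 ≤ m i ∧ m i ≤ k) ∧
      (∀ i, ∀ u ∈ U i, ∃ w : Fin (m i + 1) → List α, IsSwitchable L (U i) w u) ∧
      (∀ l : ℕ, 1 ≤ l → ∃ N : ℕ, 1 ≤ N ∧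
        ∀ x : MarkedWord α, x.word ∈ L → N ≤ x.marks →
          IsPumpable L μ N x.word ∨
          ∃ i, (U i).Infinite ∧
            ∃ (w : Fin (m i + 1) → MarkedWord α) (u : Fin (m i) → MarkedWord α),
              x = interleave w u ∧
              IsSwitchable L (U i) (fun j => (w j).word) (fun j => (u j).word) ∧
              l ≤ ∑ j, (w j).marks ∧ μ ≤ ∑ j, (u j).marks) ∧
      (∃ N : ℕ, 1 ≤ N ∧
        ∀ x : MarkedWord α, x.word ∈ L → N ≤ x.marks →
          IsPumpable L μ N x.word ∨
          ∃ i, (U i).Infinite ∧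
            ∃ (w : Fin (m i + 1) → MarkedWord α) (u : Fin (m i) → MarkedWord α),
              x = interleave w u ∧
              IsSwitchable L (U i) (fun j => (w j).word) (fun j => (u j).word) ∧
              μ ≤ ∑ j, (u j).marks ∧ ∑ j, (u j).marks ≤ N) := by
  obtain ⟨G, hrank, rfl⟩ := hL
  obtain ⟨T₀, hT₀⟩ := G.exists_switchable μ
  let e := Finite.equivFin G.Occurrence
  refine ⟨_, fun i => (e.symm i).args.length, fun i => (e.symm i).values,
    Finite.card_pos, fun i => ⟨(e.symm i).one_le_length_args, (e.symm i).length_args_le.trans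
      (hrank _)⟩, fun i u hu => (e.symm i).exists_isSwitchable hu, fun l hl => ?_, ?_⟩
  · -- With the threshold `x.marks - l`, at most `x.marks - l` marks inside mean at least `l` outside.
    refine ⟨T₀ + l, by omega, fun x hx hN => Or.inr ?_⟩
    obtain ⟨q, hq, w, u, rfl, hsw, h1, h2⟩ :=
      hT₀ (x.marks - l) x hx (by omega) (by omega)
    have h3 : l ≤ ∑ j, (w j).marks := by
      rw [MarkedWord.marks_interleave] at h2 hN
      omega
    obtain ⟨i, rfl⟩ := e.symm.surjective q
    exact ⟨i, hq, w, u, rfl, hsw, h3, h1⟩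
  · refine ⟨T₀ + 1, by omega, fun x hx hN => Or.inr ?_⟩
    obtain ⟨q, hq, w, u, hxe, hsw, h1, h2⟩ := hT₀ T₀ x hx le_rfl (by omega)
    have h3 := h2.trans T₀.le_succ
    obtain ⟨i, rfl⟩ := e.symm.surjective q
    exact ⟨i, hq, w, u, hxe, hsw, h1, h3⟩
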